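/- For a finite simple graph $H$ let $\lambda_1(H)$ denote the largest eigenvalue of its adjacency matrix. Let $G$ be a non-bipartite graph on $n$ vertices (so $n\ge 3$), and let $S=S(K_{\lfloor (n-1)/2\rfloor,\lceil (n-1)/2\rceil})$ be the graph obtained from the complete bipartite graph $K_{\lfloor (n-1)/2\rfloor,\lceil (n-1)/2\rceil}$ by subdividing one edge $uv$ (that is, deleting $uv$ and adding a new vertex adjacent to exactly $u$ and $v$; up to isomorphism $S$ does not depend on the choice of the edge). If $\lambda_1(G)\ge\lambda_1(S)$, then $G$ contains a triangle unless $G$ is isomorphic to $S$ (and if $G$ is isomorphic to $S$, it contains no triangle). -/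

import Mathlib

/-- The largest eigenvalue `λ₁(G)` of the adjacency matrix of a finite graph `G`. The spectrum of
the real symmetric adjacency matrix is a finite set of reals, nonempty as soon as `G` has a vertex,
so that the supremum is a maximum. -/
noncomputable def SimpleGraph.largestEigenvalue {V : Type*} [Fintype V] (G : SimpleGraph V) : ℝ :=
  letI : DecidableEq V := Classical.decEq V
  letI : DecidableRel G.Adj := Classical.decRel G.Adj
  sSup (spectrum ℝ (G.adjMatrix ℝ))

/-- The graph obtained from `G` by subdividing the edge `e = uv`: the edge `e` is deleted, and a new
vertex `none` is added and joined to exactly the two ends of `e`. -/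
def SimpleGraph.subdivideEdge {V : Type*} (G : SimpleGraph V) (e : Sym2 V) :
    SimpleGraph (Option V) where
  Adj
    | some x, some y => G.Adj x y ∧ s(x, y) ≠ e
    | some x, none => x ∈ e
    | none, some y => y ∈ e
    | none, none => False
  symm := ⟨by
    rintro (_ | x) (_ | y) h
    · exact h
    · exact h
    · exact h
    · exact ⟨h.1.symm, by rw [Sym2.eq_swap]; exact h.2⟩⟩
  loopless := ⟨by
    rintro (_ | x) h
    · exact h
    · exact G.loopless.irrefl x h.1⟩

/-- The balanced complete bipartite graph `K_{⌊(n-1)/2⌋, ⌈(n-1)/2⌉}`. For a natural number `n ≥ 1`,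
`⌈(n-1)/2⌉` is the natural-number quotient `n / 2`. -/
abbrev balancedCompleteBipartite (n : ℕ) : SimpleGraph (Fin ((n - 1) / 2) ⊕ Fin (n / 2)) :=
  completeBipartiteGraph (Fin ((n - 1) / 2)) (Fin (n / 2))

/-! Suppose `G` is triangle-free, and let `x` be a nonnegative eigenvector for the largest
eigenvalue, with maximum at `u`. The neighbourhood `N` of `u` is independent. As `G` is not
bipartite, some edge `w₁w₂` outside `N` prevents a 2-colouring built from `N`, and `N` splits into
two nonempty parts, one missed by `w₁` and the other by `w₂`. Turning all remaining vertices into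
twins of `u`, and completing the adjacencies of the parts with `w₁` and `w₂`, gives a pentagon
blow-up with class sizes `1, 1, s, t, r`. Maximality of `x u` makes the Rayleigh quotient no
smaller, and equality forces `G` to be that blow-up (`exists_pentagonBlowup`).

The graph `S` is itself such a blow-up, with sizes `1, 1, b, a, 1` and `|a - b| ≤ 1`. Largest
eigenvalues of these blow-ups are roots of the explicit quintic `pentagonPoly`, and comparing
quintics shows that only `S` can reach its own eigenvalue (`eq_of_pentagonPoly_eq_zero`). All
inequalities are then equalities, and `G` is `S`. -/

namespace SimpleGraph

/-! ### Rayleigh quotients and nonnegative eigenvectors. -/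

variable {V : Type*} [Fintype V]

open Classical in
/-- The sum of the values of `x` over the neighbours of `v`. -/
noncomputable def nbrSum (G : SimpleGraph V) (x : V → ℝ) (v : V) : ℝ :=
  ∑ w, if G.Adj v w then x w else 0

theorem exists_posSemidef_shift (G : SimpleGraph V) :
    ∃ M : Matrix V V ℝ, M.PosSemidef ∧
      ∀ x v, (M.mulVec x) v = G.largestEigenvalue * x v - G.nbrSum x v := by
  classical
  have hdec : G.largestEigenvalue = sSup (spectrum ℝ (G.adjMatrix ℝ)) := by
    unfold largestEigenvalue; congr!
  have hH : (G.adjMatrix ℝ).IsHermitian := by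
    rw [Matrix.IsHermitian, Matrix.conjTranspose_eq_transpose_of_trivial]
    exact SimpleGraph.transpose_adjMatrix G
  refine ⟨algebraMap ℝ (Matrix V V ℝ) G.largestEigenvalue - G.adjMatrix ℝ, ?_, ?_⟩
  · rw [Matrix.posSemidef_iff_isHermitian_and_spectrum_nonneg]
    refine ⟨?_, ?_⟩
    · refine Matrix.IsHermitian.sub ?_ hH
      rw [Matrix.algebraMap_eq_diagonal]
      exact Matrix.isHermitian_diagonal _
    · intro μ hμ
      rw [← spectrum.singleton_sub_eq, Set.singleton_sub] at hμ
      obtain ⟨ν, hν, rfl⟩ := hμ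
      have : ν ≤ G.largestEigenvalue := by
        rw [hdec]
        exact le_csSup (Matrix.finite_real_spectrum).bddAbove hν
      simpa using this
  · intro x v
    rw [Matrix.sub_mulVec, Pi.sub_apply, Matrix.algebraMap_eq_diagonal, Matrix.mulVec_diagonal]
    simp [nbrSum, Matrix.mulVec, dotProduct, adjMatrix_apply]

theorem sum_mul_nbrSum_le (G : SimpleGraph V) (y : V → ℝ) :
    ∑ v, y v * G.nbrSum y v ≤ G.largestEigenvalue * ∑ v, y v * y v := by
  obtain ⟨M, hM, hMx⟩ := G.exists_posSemidef_shift
  have h := hM.dotProduct_mulVec_nonneg y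
  simp only [dotProduct, hMx, star_trivial, mul_sub, Finset.sum_sub_distrib] at h
  rw [Finset.mul_sum]
  have : ∀ v, y v * (G.largestEigenvalue * y v) = G.largestEigenvalue * (y v * y v) :=
    fun v => by ring
  simp only [this] at h
  linarith

/-- A positive semidefinite form vanishes only on the kernel of its matrix, so a vector attaining
the Rayleigh bound is an eigenvector. -/
theorem nbrSum_eq_of_le_sum (G : SimpleGraph V) {y : V → ℝ}
    (hy : G.largestEigenvalue * ∑ v, y v * y v ≤ ∑ v, y v * G.nbrSum y v) (v : V) :
    G.nbrSum y v = G.largestEigenvalue * y v := by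
  obtain ⟨M, hM, hMx⟩ := G.exists_posSemidef_shift
  have h : star y ⬝ᵥ M.mulVec y = 0 := by
    have h' := G.sum_mul_nbrSum_le y
    simp only [dotProduct, hMx, star_trivial, mul_sub, Finset.sum_sub_distrib]
    have : ∀ v, y v * (G.largestEigenvalue * y v) = G.largestEigenvalue * (y v * y v) :=
      fun v => by ring
    simp only [this, ← Finset.mul_sum]
    linarith
  have h2 := congrFun ((hM.dotProduct_mulVec_zero_iff y).1 h) v
  rw [hMx] at h2
  simp at h2
  linarith

/-- Taking absolute values of an eigenvector keeps its norm and does not lower the quadratic form,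
so the Rayleigh bound is still attained. -/
theorem exists_nonneg_eigenvector [Nonempty V] (G : SimpleGraph V) :
    ∃ x : V → ℝ, (∀ v, 0 ≤ x v) ∧ x ≠ 0 ∧
      ∀ v, G.nbrSum x v = G.largestEigenvalue * x v := by
  classical
  have hH : (G.adjMatrix ℝ).IsHermitian := by
    rw [Matrix.IsHermitian, Matrix.conjTranspose_eq_transpose_of_trivial]
    exact SimpleGraph.transpose_adjMatrix G
  have hne : (spectrum ℝ (G.adjMatrix ℝ)).Nonempty := by
    rw [hH.spectrum_real_eq_range_eigenvalues]
    exact Set.range_nonempty _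
  have hmem : G.largestEigenvalue ∈ spectrum ℝ (G.adjMatrix ℝ) := by
    have hdec : G.largestEigenvalue = sSup (spectrum ℝ (G.adjMatrix ℝ)) := by
      unfold largestEigenvalue; congr!
    rw [hdec]
    exact hne.csSup_mem Matrix.finite_real_spectrum
  rw [← Matrix.spectrum_toLin', ← Module.End.hasEigenvalue_iff_mem_spectrum] at hmem
  obtain ⟨x, hx⟩ := hmem.exists_hasEigenvector
  have hxe : ∀ v, G.nbrSum x v = G.largestEigenvalue * x v := by
    intro v
    have := congrFun hx.apply_eq_smul v
    simpa [nbrSum, Matrix.mulVec, dotProduct, adjMatrix_apply] using this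
  refine ⟨fun v => |x v|, fun v => abs_nonneg _, ?_, ?_⟩
  · intro h
    apply hx.2
    funext v
    simpa using congrFun h v
  · apply nbrSum_eq_of_le_sum
    simp only [abs_mul_abs_self]
    rw [Finset.mul_sum]
    refine Finset.sum_le_sum fun v _ => ?_
    have h1 : G.largestEigenvalue * (x v * x v) = x v * G.nbrSum x v := by rw [hxe]; ring
    rw [h1]
    refine (le_abs_self _).trans ?_
    rw [abs_mul]
    refine mul_le_mul_of_nonneg_left ?_ (abs_nonneg _)
    unfold nbrSum
    refine (Finset.abs_sum_le_sum_abs _ _).trans (Finset.sum_le_sum fun w _ => ?_)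
    split_ifs <;> simp

end SimpleGraph

/-! ### Blow-ups of the pentagon and their largest eigenvalues. -/

namespace SimpleGraph

/-- The blow-up of the pentagon in which the fibre of `c` over `i` replaces the vertex `i`. -/
def pentagonBlowup {V : Type*} (c : V → Fin 5) : SimpleGraph V := (cycleGraph 5).comap c

theorem pentagonBlowup_adj {V : Type*} {c : V → Fin 5} {v w : V} :
    (pentagonBlowup c).Adj v w ↔ c w = c v + 1 ∨ c w = c v - 1 := by
  have : ∀ i j : Fin 5, (cycleGraph 5).Adj i j ↔ j = i + 1 ∨ j = i - 1 := by decide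
  exact this _ _

theorem pentagonBlowup_comp {V : Type*} (c : V → Fin 5) (f : Fin 5 → Fin 5)
    (hf : ∀ i j, (f j = f i + 1 ∨ f j = f i - 1) ↔ (j = i + 1 ∨ j = i - 1)) :
    pentagonBlowup (fun v => f (c v)) = pentagonBlowup c := by
  ext v w
  rw [pentagonBlowup_adj, pentagonBlowup_adj]
  exact hf _ _

theorem nonempty_iso_pentagonBlowup {V W : Type*} [Fintype V] [Fintype W]
    (c : V → Fin 5) (c' : W → Fin 5)
    (h : ∀ i, (Finset.univ.filter (c · = i)).card = (Finset.univ.filter (c' · = i)).card) :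
    Nonempty (pentagonBlowup c ≃g pentagonBlowup c') := by
  have h' : ∀ i, Nonempty ({v // c v = i} ≃ {w // c' w = i}) := fun i =>
    ⟨Fintype.equivOfCardEq (by rw [Fintype.card_subtype, Fintype.card_subtype]; exact h i)⟩
  let e : V ≃ W := (Equiv.sigmaFiberEquiv c).symm.trans
    ((Equiv.sigmaCongrRight fun i => (h' i).some).trans (Equiv.sigmaFiberEquiv c'))
  have he : ∀ v, c' (e v) = c v := fun v => ((h' (c v)).some ⟨v, rfl⟩).2
  exact ⟨⟨e, fun {v w} => by rw [pentagonBlowup_adj, pentagonBlowup_adj, he, he]⟩⟩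

variable {V : Type*} [Fintype V]

theorem nbrSum_pentagonBlowup (c : V → Fin 5) (x : V → ℝ) (v : V) :
    (pentagonBlowup c).nbrSum x v =
      (∑ w with c w = c v + 1, x w) + ∑ w with c w = c v - 1, x w := by
  rw [nbrSum, Finset.sum_filter, Finset.sum_filter, ← Finset.sum_add_distrib]
  refine Finset.sum_congr rfl fun w _ => ?_
  have : ∀ i : Fin 5, i + 1 ≠ i - 1 := by decide
  have := this (c v)
  simp only [pentagonBlowup_adj]
  by_cases h1 : c w = c v + 1
  · have h2 : c w ≠ c v - 1 := fun h => this (h1.symm.trans h)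
    simp [h1, this]
  · simp [h1]

theorem sum_eq_sum_fibers (c : V → Fin 5) (x : V → ℝ) :
    ∑ v, x v = ∑ i, ∑ v with c v = i, x v :=
  (Finset.sum_fiberwise _ c x).symm

/-- The characteristic polynomial of the quotient matrix of a blow-up of the pentagon with classes
of sizes `1, 1, s, t, r`. -/
def pentagonPoly (s t r l : ℝ) : ℝ :=
  l ^ 5 - (1 + (r + s) * (t + 1)) * l ^ 3 + ((r + s) * t + r * s * (1 + 2 * t)) * l - 2 * t * (r * s)

theorem pentagonPoly_eq_zero {s t r l F0 F1 F2 F3 F4 : ℝ} (hl : 0 < l) (hs : 0 < s) (ht : 0 < t)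
    (hr : 0 < r) (h0 : 0 ≤ F0) (h1 : 0 ≤ F1) (h2 : 0 ≤ F2) (h3 : 0 ≤ F3) (h4 : 0 ≤ F4)
    (hsum : F0 + F1 + F2 + F3 + F4 ≠ 0)
    (e0 : l * F0 = F1 + F4) (e1 : l * F1 = F2 + F0) (e2 : l * F2 = s * (F3 + F1))
    (e3 : l * F3 = t * (F4 + F2)) (e4 : l * F4 = r * (F0 + F3)) :
    pentagonPoly s t r l = 0 := by
  -- If `F3` vanished, nonnegativity and the equations would make every class sum vanish.
  have hF3 : F3 ≠ 0 := by
    rintro rfl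
    have h42 : F4 + F2 = 0 := by
      have : t * (F4 + F2) = 0 := by linarith
      exact (mul_eq_zero.1 this).resolve_left ht.ne'
    have h2' : F2 = 0 := by linarith
    have h4' : F4 = 0 := by linarith
    subst h2' h4'
    have h1' : F1 = 0 := by
      have : s * F1 = 0 := by linarith
      exact (mul_eq_zero.1 this).resolve_left hs.ne'
    have h0' : F0 = 0 := by
      have : r * F0 = 0 := by linarith
      exact (mul_eq_zero.1 this).resolve_left hr.ne'
    subst h1' h0'
    simp at hsum
  -- Eliminating `F2` and `F4` leaves a 2×2 system for `F0, F1` in terms of `F3`; `d0` and `d1` are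
  -- Cramer's rule without division.
  have a : (l ^ 2 - s) * F1 - l * F0 = s * F3 := by linear_combination l * e1 + e2
  have b : (l ^ 2 - r) * F0 - l * F1 = r * F3 := by linear_combination l * e0 + e4
  have d0 : ((l ^ 2 - r) * (l ^ 2 - s) - l ^ 2) * F0 = (r * (l ^ 2 - s) + l * s) * F3 := by
    linear_combination (l ^ 2 - s) * b + l * a
  have d1 : ((l ^ 2 - r) * (l ^ 2 - s) - l ^ 2) * F1 = (s * (l ^ 2 - r) + l * r) * F3 := by
    linear_combination (l ^ 2 - r) * a + l * b
  have e : l ^ 2 * F3 = t * (s * (F1 + F3) + r * (F3 + F0)) := by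
    linear_combination l * e3 + t * e2 + t * e4
  have key : (l * F3) * pentagonPoly s t r l = 0 := by
    unfold pentagonPoly
    linear_combination ((l ^ 2 - r) * (l ^ 2 - s) - l ^ 2) * e + t * s * d1 + t * r * d0
  exact (mul_eq_zero.1 key).resolve_left (mul_ne_zero hl.ne' hF3)

theorem pentagonPoly_largestEigenvalue [Nonempty V] (c : V → Fin 5) {s t r : ℕ}
    (hl : 0 < (pentagonBlowup c).largestEigenvalue) (hs : 0 < s) (ht : 0 < t) (hr : 0 < r)
    (n0 : (Finset.univ.filter (c · = 0)).card = 1) (n1 : (Finset.univ.filter (c · = 1)).card = 1)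
    (n2 : (Finset.univ.filter (c · = 2)).card = s) (n3 : (Finset.univ.filter (c · = 3)).card = t)
    (n4 : (Finset.univ.filter (c · = 4)).card = r) :
    pentagonPoly s t r (pentagonBlowup c).largestEigenvalue = 0 := by
  obtain ⟨x, hx0, hxne, hx⟩ := (pentagonBlowup c).exists_nonneg_eigenvector
  set l := (pentagonBlowup c).largestEigenvalue
  have hF : ∀ i : Fin 5, l * (∑ v with c v = i, x v) = (Finset.univ.filter (c · = i)).card *
      ((∑ w with c w = i + 1, x w) + ∑ w with c w = i - 1, x w) := by
    intro i
    rw [Finset.mul_sum, ← nsmul_eq_mul, ← Finset.sum_const]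
    refine Finset.sum_congr rfl fun v hv => ?_
    rw [← hx, nbrSum_pentagonBlowup, (Finset.mem_filter.1 hv).2]
  have hn : ∀ i : Fin 5, 0 ≤ ∑ v with c v = i, x v := fun i =>
    Finset.sum_nonneg fun v _ => hx0 v
  refine pentagonPoly_eq_zero (F0 := ∑ v with c v = 0, x v) (F1 := ∑ v with c v = 1, x v)
    (F2 := ∑ v with c v = 2, x v) (F3 := ∑ v with c v = 3, x v) (F4 := ∑ v with c v = 4, x v)
    hl (by exact_mod_cast hs) (by exact_mod_cast ht) (by exact_mod_cast hr)
    (hn 0) (hn 1) (hn 2) (hn 3) (hn 4) ?_ ?_ ?_ ?_ ?_ ?_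
  · have := sum_eq_sum_fibers c x
    rw [Fin.sum_univ_five] at this
    rw [← this]
    intro h
    rw [Finset.sum_eq_zero_iff_of_nonneg fun v _ => hx0 v] at h
    exact hxne (funext fun v => h v (Finset.mem_univ v))
  · have := hF 0
    rw [n0, show (0 : Fin 5) - 1 = 4 from rfl] at this
    simpa using this
  · have := hF 1
    rw [n1] at this
    simpa using this
  · have := hF 2
    rw [n2] at this
    simpa using this
  · have := hF 3
    rw [n3] at this
    simpa using this
  · have := hF 4
    rw [n4] at this
    simpa using this

/-- The Rayleigh quotient of the all-ones vector is the average degree. -/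
theorem two_mul_le_largestEigenvalue_mul (c : V → Fin 5) {s t r : ℕ}
    (n0 : (Finset.univ.filter (c · = 0)).card = 1) (n1 : (Finset.univ.filter (c · = 1)).card = 1)
    (n2 : (Finset.univ.filter (c · = 2)).card = s) (n3 : (Finset.univ.filter (c · = 3)).card = t)
    (n4 : (Finset.univ.filter (c · = 4)).card = r) :
    (2 * (1 + s + s * t + t * r + r) : ℝ) ≤
      (pentagonBlowup c).largestEigenvalue * (2 + s + t + r) := by
  have h := (pentagonBlowup c).sum_mul_nbrSum_le fun _ => 1
  simp only [nbrSum_pentagonBlowup, mul_one, one_mul] at h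
  rw [sum_eq_sum_fibers c, sum_eq_sum_fibers c] at h
  have hi : ∀ i : Fin 5, ∑ v with c v = i, ((∑ w with c w = c v + 1, (1 : ℝ)) +
      ∑ w with c w = c v - 1, (1 : ℝ)) = (Finset.univ.filter (c · = i)).card *
      ((Finset.univ.filter (c · = i + 1)).card + (Finset.univ.filter (c · = i - 1)).card) := by
    intro i
    rw [← nsmul_eq_mul, ← Finset.sum_const]
    refine Finset.sum_congr rfl fun v hv => ?_
    rw [(Finset.mem_filter.1 hv).2]
    simp
  simp only [hi] at h
  simp only [Fin.sum_univ_five, Finset.sum_const, nsmul_eq_mul, mul_one] at h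
  have r1 : (0 : Fin 5) - 1 = 4 := rfl
  have r2 : (1 : Fin 5) - 1 = 0 := rfl
  have r3 : (2 : Fin 5) - 1 = 1 := rfl
  have r4 : (3 : Fin 5) - 1 = 2 := rfl
  have r5 : (4 : Fin 5) - 1 = 3 := rfl
  have r6 : (0 : Fin 5) + 1 = 1 := rfl
  have r7 : (1 : Fin 5) + 1 = 2 := rfl
  have r8 : (2 : Fin 5) + 1 = 3 := rfl
  have r9 : (3 : Fin 5) + 1 = 4 := rfl
  have r0 : (4 : Fin 5) + 1 = 0 := rfl
  rw [r0, r1, r2, r3, r4, r5, r6, r7, r8, r9, n0, n1, n2, n3, n4] at h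
  push_cast at h
  linarith

/-- Among the pentagon blow-ups with classes of sizes `1, 1, s, t, r` on a given number of vertices, the
balanced one with `r = 1` has the largest root of `pentagonPoly`, and it is the only one up to symmetry. -/
theorem eq_of_pentagonPoly_eq_zero {a b s t r : ℕ} {μ ν : ℝ} (ha : 0 < a) (hb : 0 < b)
    (hs : 0 < s) (ht : 0 < t) (hr : 0 < r) (hab : a ≤ b) (hba : b ≤ a + 1)
    (hsum : s + t + r = a + b + 1) (hν1 : 1 < ν)
    (hν : (2 * (1 + b + b * a + a + 1) : ℝ) ≤ ν * (3 + a + b))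
    (hνμ : ν ≤ μ) (h1 : pentagonPoly b a 1 ν = 0) (h2 : pentagonPoly s t r μ = 0) :
    μ = ν ∧ (r = 1 ∨ s = 1) ∧ (r + s - 1) * t = a * b := by
  obtain ⟨c, hc⟩ : ∃ c, r + s = c + 1 := ⟨r + s - 1, by omega⟩
  have hcN : r + s - 1 = c := by omega
  have hct : c + t = a + b := by omega
  have hq : (c * t : ℝ) ≤ a * b := by
    have : c * t ≤ a * b := by
      rcases le_or_gt t a with h | h
      · obtain ⟨k, rfl⟩ := Nat.exists_eq_add_of_le h
        obtain rfl : c = k + b := by omega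
        nlinarith [Nat.zero_le k]
      · obtain ⟨k, rfl⟩ := Nat.exists_eq_add_of_lt h
        obtain rfl | rfl : b = a ∨ b = a + 1 := by omega
        · obtain ⟨j, rfl⟩ : ∃ j, b = j + k + 1 := ⟨b - k - 1, by omega⟩
          obtain rfl : c = j := by omega
          nlinarith
        · obtain ⟨j, rfl⟩ : ∃ j, a = j + k := ⟨a - k, by omega⟩
          obtain rfl : c = j := by omega
          nlinarith
    exact_mod_cast this
  have hrs : (c : ℝ) ≤ r * s := by
    have : c ≤ r * s := by
      obtain ⟨r', rfl⟩ : ∃ r', r = r' + 1 := ⟨r - 1, by omega⟩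
      obtain ⟨s', rfl⟩ : ∃ s', s = s' + 1 := ⟨s - 1, by omega⟩
      nlinarith [Nat.zero_le (r' * s')]
    exact_mod_cast this
  have ha' : (1 : ℝ) ≤ a := by exact_mod_cast ha
  have hb' : (1 : ℝ) ≤ b := by exact_mod_cast hb
  have hab' : (a : ℝ) ≤ b := by exact_mod_cast hab
  have hba' : (b : ℝ) ≤ a + 1 := by exact_mod_cast hba
  have ht' : (1 : ℝ) ≤ t := by exact_mod_cast ht
  have hc' : (r : ℝ) + s = c + 1 := by exact_mod_cast hc
  have hct' : (c : ℝ) + t = a + b := by exact_mod_cast hct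
  have hμ1 : 1 < μ := hν1.trans_le hνμ
  -- With `m = 2 + a + b + ab` edges on `N = 3 + a + b` vertices, `ν ≥ 2m/N`; balance gives `N² ≤
  -- 8m`, hence `2ν² ≥ m`.
  have hsq : (2 + a + b + a * b : ℝ) ≤ 2 * ν ^ 2 := by
    have hm : (0 : ℝ) < 2 + a + b + a * b := by positivity
    have hN : (0 : ℝ) < 3 + a + b := by positivity
    have h3 : (2 * (2 + a + b + a * b) : ℝ) ^ 2 ≤ (ν * (3 + a + b)) ^ 2 :=
      pow_le_pow_left₀ (by positivity) (by linarith) 2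
    have h4 : ((3 + a + b) ^ 2 : ℝ) ≤ 8 * (2 + a + b + a * b) := by
      nlinarith [mul_nonneg (sub_nonneg.2 hab') (sub_nonneg.2 hba')]
    have h5 := mul_le_mul_of_nonneg_left h4 hm.le
    have h6 : (2 + a + b + a * b : ℝ) * (3 + a + b) ^ 2 ≤ 2 * ν ^ 2 * (3 + a + b) ^ 2 := by
      linarith
    exact le_of_mul_le_mul_right h6 (by positivity)
  -- The comparison passes through sizes `(c, t, 1)`: concentrating `r + s` as `c + 1` costs the `rs
  -- - c` term, and balancing `c, t` costs the `ab - ct` term. Both are nonnegative.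
  have split : pentagonPoly s t r μ = pentagonPoly b a 1 μ + (a * b - c * t) * ((μ - 1) ^ 2 * (μ + 2))
      + (r * s - c) * (t * (2 * (μ - 1)) + μ) := by
    have hr2 : (r : ℝ) = c + 1 - s := by linarith
    have hb2 : (b : ℝ) = c + t - a := by linarith
    unfold pentagonPoly
    rw [hb2, hr2]
    ring
  have k1 : 0 ≤ (a * b - c * t : ℝ) * ((μ - 1) ^ 2 * (μ + 2)) :=
    mul_nonneg (by linarith) (by positivity)
  have k2pos : (0 : ℝ) < t * (2 * (μ - 1)) + μ := by
    have : 0 < μ - 1 := by linarith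
    positivity
  have k2 : 0 ≤ (r * s - c : ℝ) * (t * (2 * (μ - 1)) + μ) := mul_nonneg (by linarith) k2pos.le
  have hμν : μ = ν := by
    by_contra hne
    have hlt : ν < μ := lt_of_le_of_ne hνμ (Ne.symm hne)
    -- This shows that `pentagonPoly b a 1` divided by its variable is larger at `μ` than at `ν`;
    -- `hsq` makes the last factor of the first term positive.
    have hid : ν * pentagonPoly b a 1 μ - μ * pentagonPoly b a 1 ν =
        μ * ν * ((μ ^ 2 - ν ^ 2) * (μ ^ 2 + ν ^ 2 - (2 + a + b + a * b)))
          + 2 * (a * b) * (μ - ν) := by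
      unfold pentagonPoly; ring
    have hsq2 : ν ^ 2 < μ ^ 2 := pow_lt_pow_left₀ hlt (by linarith) (by norm_num)
    have p1 : 0 < μ * ν * ((μ ^ 2 - ν ^ 2) * (μ ^ 2 + ν ^ 2 - (2 + a + b + a * b))) :=
      mul_pos (mul_pos (by linarith) (by linarith)) (mul_pos (by linarith) (by linarith))
    have p2 : (0 : ℝ) ≤ 2 * (a * b) * (μ - ν) := mul_nonneg (by positivity) (by linarith)
    rw [h1, mul_zero, sub_zero] at hid
    have p3 : 0 < pentagonPoly b a 1 μ := by
      refine pos_of_mul_pos_right (a := ν) ?_ (by linarith)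
      rw [hid]; linarith
    linarith
  subst hμν
  refine ⟨rfl, ?_, ?_⟩
  · have h3 : (r * s - c : ℝ) * (t * (2 * (μ - 1)) + μ) = 0 := by linarith
    have h4 := (mul_eq_zero.1 h3).resolve_right k2pos.ne'
    have h5 : ((r : ℝ) - 1) * (s - 1) = 0 := by linarith
    rcases mul_eq_zero.1 h5 with h | h
    · left; exact_mod_cast sub_eq_zero.1 h
    · right; exact_mod_cast sub_eq_zero.1 h
  · have h3 : (a * b - c * t : ℝ) * ((μ - 1) ^ 2 * (μ + 2)) = 0 := by linarith
    have hp : (0 : ℝ) < (μ - 1) ^ 2 * (μ + 2) :=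
      mul_pos (pow_pos (by linarith) 2) (by linarith)
    have h4 := (mul_eq_zero.1 h3).resolve_right hp.ne'
    rw [hcN]
    have : (c * t : ℝ) = a * b := by linarith
    exact_mod_cast this

end SimpleGraph

/-! ### From a triangle-free non-bipartite graph to a pentagon blow-up. -/

namespace SimpleGraph

/-- Otherwise one colour for `N` and the vertices with no neighbour in `N`, and another for the
rest, would be a proper 2-colouring. -/
theorem exists_adj_notMem_of_not_isBipartite {V : Type*} (G : SimpleGraph V) (hG : ¬ G.IsBipartite)
    (N : Set V) (hN : ∀ v ∈ N, ∀ w ∈ N, ¬ G.Adj v w) :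
    ∃ v w, v ∉ N ∧ w ∉ N ∧ G.Adj v w ∧ ((∃ z ∈ N, G.Adj v z) ↔ ∃ z ∈ N, G.Adj w z) := by
  classical
  by_contra! hcon
  apply hG
  rw [isBipartite_iff_exists_isBipartiteWith]
  refine ⟨{v | v ∈ N ∨ ¬ ∃ z ∈ N, G.Adj v z}, {v | v ∉ N ∧ ∃ z ∈ N, G.Adj v z}, ?_, ?_⟩
  · rw [Set.disjoint_left]
    rintro v (h | h) ⟨h1, h2⟩
    · exact h1 h
    · exact h h2
  · intro v w hvw
    by_cases hv : v ∈ N <;> by_cases hw : w ∈ N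
    · exact absurd hvw (hN v hv w hw)
    · exact Or.inl ⟨Or.inl hv, hw, v, hv, hvw.symm⟩
    · exact Or.inr ⟨⟨hv, w, hw, hvw⟩, Or.inl hw⟩
    · rcases hcon v w hv hw hvw with ⟨h1, h2⟩ | ⟨h1, h2⟩
      · exact Or.inr ⟨⟨hv, h1⟩, Or.inr fun ⟨z, hz, h⟩ => h2 z hz h⟩
      · exact Or.inl ⟨Or.inr fun ⟨z, hz, h⟩ => h1 z hz h, hw, h2⟩

variable {V : Type*} [Fintype V]

-- Doubling the sum over `T` counts the crossing pairs correctly but the pairs inside `T` twice.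
-- This isolates the part of the form that does not involve `T`.
open Classical in
theorem sum_mul_nbrSum_split (G : SimpleGraph V) (x : V → ℝ) (T : Finset V) :
    ∑ v, x v * G.nbrSum x v = 2 * (∑ v ∈ T, x v * G.nbrSum x v)
      - (∑ v ∈ T, ∑ w ∈ T, if G.Adj v w then x v * x w else 0)
      + ∑ v ∈ Tᶜ, ∑ w ∈ Tᶜ, if G.Adj v w then x v * x w else 0 := by
  have h : ∀ v, x v * G.nbrSum x v = (∑ w ∈ T, if G.Adj v w then x v * x w else 0)
      + ∑ w ∈ Tᶜ, if G.Adj v w then x v * x w else 0 := by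
    intro v
    rw [nbrSum, Finset.sum_add_sum_compl, Finset.mul_sum]
    exact Finset.sum_congr rfl fun w _ => by split_ifs <;> simp
  have hc : (∑ v ∈ Tᶜ, ∑ w ∈ T, if G.Adj v w then x v * x w else 0) =
      ∑ v ∈ T, ∑ w ∈ Tᶜ, if G.Adj v w then x v * x w else 0 := by
    rw [Finset.sum_comm]
    exact Finset.sum_congr rfl fun v _ => Finset.sum_congr rfl fun w _ => by
      simp only [G.adj_comm, mul_comm]
  rw [← Finset.sum_add_sum_compl T]
  simp only [h, Finset.sum_add_distrib]
  rw [hc]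
  ring

/-- Replacing the vertices of `T` by twins of a vertex at which the eigenvector `x` takes the
value `m` does not decrease the Rayleigh quotient. -/
theorem le_sum_mul_nbrSum_of_twins (G H : SimpleGraph V) (T : Finset V) {x y : V → ℝ} {l m : ℝ}
    (hx0 : ∀ v, 0 ≤ x v) (hx : ∀ v, G.nbrSum x v = l * x v)
    (hyT : ∀ v ∈ T, y v = m) (hy : ∀ v ∉ T, y v = x v)
    (hHT : ∀ v ∈ T, ∀ w ∈ T, ¬ H.Adj v w) (hGH : ∀ v ∉ T, ∀ w ∉ T, G.Adj v w → H.Adj v w)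
    (hsum : ∀ v ∈ T, H.nbrSum y v = l * m) :
    l * ∑ v, y v * y v + l * ∑ v ∈ T, (m * m - x v * x v) ≤ ∑ v, y v * H.nbrSum y v := by
  classical
  have h1 := G.sum_mul_nbrSum_split x T
  have h2 := H.sum_mul_nbrSum_split y T
  have h3 : (∑ v ∈ T, ∑ w ∈ T, if H.Adj v w then y v * y w else 0) = 0 :=
    Finset.sum_eq_zero fun v hv => Finset.sum_eq_zero fun w hw => if_neg (hHT v hv w hw)
  have h4 : 0 ≤ ∑ v ∈ T, ∑ w ∈ T, if G.Adj v w then x v * x w else 0 :=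
    Finset.sum_nonneg fun v _ => Finset.sum_nonneg fun w _ => by
      split_ifs
      · exact mul_nonneg (hx0 v) (hx0 w)
      · exact le_rfl
  have h5 : (∑ v ∈ Tᶜ, ∑ w ∈ Tᶜ, if G.Adj v w then x v * x w else 0) ≤
      ∑ v ∈ Tᶜ, ∑ w ∈ Tᶜ, if H.Adj v w then y v * y w else 0 := by
    refine Finset.sum_le_sum fun v hv => Finset.sum_le_sum fun w hw => ?_
    rw [Finset.mem_compl] at hv hw
    rw [hy v hv, hy w hw]
    by_cases h : G.Adj v w
    · rw [if_pos h, if_pos (hGH v hv w hw h)]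
    · rw [if_neg h]
      split_ifs
      · exact mul_nonneg (hx0 v) (hx0 w)
      · exact le_rfl
  have h6 : ∑ v, x v * G.nbrSum x v = l * ∑ v, x v * x v := by
    rw [Finset.mul_sum]
    exact Finset.sum_congr rfl fun v _ => by rw [hx]; ring
  have h7 : ∑ v ∈ T, x v * G.nbrSum x v = l * ∑ v ∈ T, x v * x v := by
    rw [Finset.mul_sum]
    exact Finset.sum_congr rfl fun v _ => by rw [hx]; ring
  have h8 : ∑ v ∈ T, y v * H.nbrSum y v = l * ∑ v ∈ T, m * m := by
    rw [Finset.mul_sum]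
    exact Finset.sum_congr rfl fun v hv => by rw [hsum v hv, hyT v hv]; ring
  have h9 : ∑ v, x v * x v = ∑ v ∈ T, x v * x v + ∑ v ∈ Tᶜ, x v * x v :=
    (Finset.sum_add_sum_compl T _).symm
  have h10 : ∑ v, y v * y v = ∑ v ∈ T, m * m + ∑ v ∈ Tᶜ, x v * x v := by
    rw [← Finset.sum_add_sum_compl T]
    congr 1
    · exact Finset.sum_congr rfl fun v hv => by rw [hyT v hv]
    · exact Finset.sum_congr rfl fun v hv => by rw [hy v (Finset.mem_compl.1 hv)]
  rw [h6, h7, h9] at h1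
  rw [h8, h3] at h2
  rw [h2, h10, Finset.sum_sub_distrib]
  linear_combination h1 + h4 + h5

theorem adj_iff_of_nbrSum_eq (G H : SimpleGraph V) {x : V → ℝ} (hx : ∀ v, 0 < x v) {z : V}
    (hz : ∀ w, G.Adj z w → H.Adj z w) (h : G.nbrSum x z = H.nbrSum x z) (w : V) :
    G.Adj z w ↔ H.Adj z w := by
  classical
  refine ⟨hz w, fun hw => ?_⟩
  by_contra hGw
  refine absurd h (ne_of_lt ?_)
  refine Finset.sum_lt_sum (fun v _ => ?_) ⟨w, Finset.mem_univ w, ?_⟩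
  · by_cases hv : G.Adj z v
    · rw [if_pos hv, if_pos (hz v hv)]
    · rw [if_neg hv]
      split_ifs
      · exact (hx v).le
      · exact le_rfl
  · rw [if_neg hGw, if_pos hw]
    exact hx w

theorem CliqueFree.false_of_adj {V : Type*} {G : SimpleGraph V} (h : G.CliqueFree 3) {a b c : V}
    (hab : G.Adj a b) (hac : G.Adj a c) (hbc : G.Adj b c) : False := by
  classical
  exact h {a, b, c} (is3Clique_triple_iff.2 ⟨hab, hac, hbc⟩)

/-- Class 3 consists of the vertices made twins of `u`, and raising their entries to `x u` gives the
test vector. In the equality case `x` is a positive eigenvector of both graphs, so no edge at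
classes 2 and 4 can have been added, and triangle-freeness excludes any further edge at class 3. -/
theorem exists_pentagonBlowup_of_fibers (G : SimpleGraph V) (hG : G.CliqueFree 3) {x : V → ℝ}
    (hx0 : ∀ v, 0 ≤ x v) (hx : ∀ v, G.nbrSum x v = G.largestEigenvalue * x v)
    (hl : 0 < G.largestEigenvalue) {u w₁ w₂ : V} (hu : 0 < x u) (hmax : ∀ v, x v ≤ x u)
    (c : V → Fin 5) (c0 : ∀ v, c v = 0 ↔ v = w₁) (c1 : ∀ v, c v = 1 ↔ v = w₂) (hu3 : c u = 3)
    (hN : ∀ v, G.Adj u v ↔ c v = 2 ∨ c v = 4) (h2 : ∃ v, c v = 2) (h4 : ∃ v, c v = 4)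
    (h12 : G.Adj w₁ w₂) (hw1 : ∀ v, c v = 2 → ¬ G.Adj w₁ v) (hw2 : ∀ v, c v = 4 → ¬ G.Adj w₂ v) :
    G.largestEigenvalue ≤ (pentagonBlowup c).largestEigenvalue ∧
      ((pentagonBlowup c).largestEigenvalue ≤ G.largestEigenvalue → G = pentagonBlowup c) := by
  classical
  set H := pentagonBlowup c with hH
  set l := G.largestEigenvalue with hldef
  have c0' : c w₁ = 0 := (c0 _).2 rfl
  have c1' : c w₂ = 1 := (c1 _).2 rfl
  have hadj : ∀ v w, H.Adj v w ↔ c w = c v + 1 ∨ c w = c v - 1 := fun v w => pentagonBlowup_adj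
  have hNN : ∀ v w, (c v = 2 ∨ c v = 4) → (c w = 2 ∨ c w = 4) → ¬ G.Adj v w := fun v w hv hw h =>
    hG.false_of_adj ((hN v).2 hv) ((hN w).2 hw) h
  have hGH' : ∀ v w, G.Adj v w → (c v = 2 ∨ c v = 4) → H.Adj v w := by
    intro v w hvw hv
    rw [hadj]
    have hw : ¬ (c w = 2 ∨ c w = 4) := fun hw => hNN v w hv hw hvw
    have key : ∀ i j : Fin 5, (i = 2 ∨ i = 4) → ¬ (j = 2 ∨ j = 4) →
        (j = 0 → i ≠ 2) → (j = 1 → i ≠ 4) → (j = i + 1 ∨ j = i - 1) := by decide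
    refine key _ _ hv hw (fun h0 h => ?_) (fun h1 h => ?_)
    · rw [c0] at h0; subst h0; exact hw1 v h hvw.symm
    · rw [c1] at h1; subst h1; exact hw2 v h hvw.symm
  have hGH : ∀ v, c v ≠ 3 → ∀ w, c w ≠ 3 → G.Adj v w → H.Adj v w := by
    intro v hv w hw hvw
    by_cases hv' : c v = 2 ∨ c v = 4
    · exact hGH' v w hvw hv'
    by_cases hw' : c w = 2 ∨ c w = 4
    · exact (hGH' w v hvw.symm hw').symm
    have key : ∀ i : Fin 5, i ≠ 3 → ¬ (i = 2 ∨ i = 4) → i = 0 ∨ i = 1 := by decide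
    rw [hadj]
    rcases key _ hv hv' with h | h <;> rcases key _ hw hw' with h' | h'
    · rw [c0] at h h'; subst h h'; exact absurd hvw (G.irrefl)
    · rw [h, h']; decide
    · rw [h, h']; decide
    · rw [c1] at h h'; subst h h'; exact absurd hvw (G.irrefl)
  let y : V → ℝ := fun v => if c v = 3 then x u else x v
  have hy0 : ∀ v, 0 ≤ y v := fun v => by
    simp only [y]; split_ifs
    exacts [hu.le, hx0 v]
  have hy : l * ∑ v, y v * y v + l * ∑ v with c v = 3, (x u * x u - x v * x v) ≤
      ∑ v, y v * H.nbrSum y v := by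
    refine le_sum_mul_nbrSum_of_twins G H _ hx0 hx ?_ ?_ ?_ ?_ ?_
    · intro v hv; simp only [y]; rw [if_pos (Finset.mem_filter.1 hv).2]
    · intro v hv
      simp only [Finset.mem_filter_univ] at hv
      simp only [y]; rw [if_neg hv]
    · intro v hv w hw
      simp only [Finset.mem_filter_univ] at hv hw
      rw [hadj, hv, hw]; decide
    · intro v hv w hw
      simp only [Finset.mem_filter_univ] at hv hw
      exact hGH v hv w hw
    · intro v hv
      simp only [Finset.mem_filter_univ] at hv
      rw [← hx u]
      refine Finset.sum_congr rfl fun w _ => ?_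
      -- A vertex of class 3 has in `H` exactly the neighbours of `u` in `G`.
      have e : H.Adj v w ↔ G.Adj u w := by
        rw [hadj, hN, hv]
        exact or_comm
      simp only [e]
      split_ifs with h
      · have : c w ≠ 3 := by
          rcases (hN w).1 h with h | h <;> rw [h] <;> decide
        simp only [y]; rw [if_neg this]
      · rfl
  have hT : 0 ≤ ∑ v with c v = 3, (x u * x u - x v * x v) := Finset.sum_nonneg fun v _ =>
    sub_nonneg.2 (mul_self_le_mul_self (hx0 v) (hmax v))
  have hle := H.sum_mul_nbrSum_le y
  have hyy : 0 < ∑ v, y v * y v := by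
    refine Finset.sum_pos' (fun v _ => mul_self_nonneg _) ⟨u, Finset.mem_univ u, ?_⟩
    simp only [y]; rw [if_pos hu3]; positivity
  refine ⟨?_, fun hHl => ?_⟩
  · refine le_of_mul_le_mul_right ?_ hyy
    have := mul_nonneg hl.le hT
    linarith
  have hHl' := mul_le_mul_of_nonneg_right hHl hyy.le
  have hT0 : ∑ v with c v = 3, (x u * x u - x v * x v) = 0 := by
    refine le_antisymm ?_ hT
    refine nonpos_of_mul_nonpos_right ?_ hl
    linarith
  have hxT : ∀ v, c v = 3 → x v = x u := by
    intro v hv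
    have h := (Finset.sum_eq_zero_iff_of_nonneg fun v _ =>
      sub_nonneg.2 (mul_self_le_mul_self (hx0 v) (hmax v))).1 hT0 v (by simpa using hv)
    exact ((mul_self_inj hu.le (hx0 v)).1 (sub_eq_zero.1 h)).symm
  have hyx : y = x := by
    funext v
    simp only [y]
    split_ifs with h
    · exact (hxT v h).symm
    · rfl
  have hlH : H.largestEigenvalue = l := by
    refine le_antisymm hHl (le_of_mul_le_mul_right ?_ hyy)
    have := mul_nonneg hl.le hT
    linarith
  have hHx : ∀ v, H.nbrSum x v = l * x v := by
    intro v
    rw [← hlH, ← hyx]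
    refine H.nbrSum_eq_of_le_sum ?_ v
    rw [hlH]
    have := mul_nonneg hl.le hT
    linarith
  have hpos : ∀ v w, H.Adj v w → 0 < x w → 0 < x v := by
    intro v w hvw hw
    have h1 : x w ≤ H.nbrSum x v := by
      have := Finset.single_le_sum (f := fun w => if H.Adj v w then x w else 0)
        (fun w _ => by split_ifs; exacts [hx0 w, le_rfl]) (Finset.mem_univ w)
      rw [if_pos hvw] at this
      exact this.trans (le_of_eq (Finset.sum_congr rfl fun w _ => by congr))
    rw [hHx] at h1
    exact pos_of_mul_pos_right (hw.trans_le h1) hl.le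
  have hxpos2 : ∀ v, c v = 2 → 0 < x v := fun v hv =>
    hpos v u ((hadj _ _).2 (by rw [hv, hu3]; decide)) hu
  have hxpos4 : ∀ v, c v = 4 → 0 < x v := fun v hv =>
    hpos v u ((hadj _ _).2 (by rw [hv, hu3]; decide)) hu
  obtain ⟨z2, hz2⟩ := h2
  obtain ⟨z4, hz4⟩ := h4
  have hxpos : ∀ v, 0 < x v := by
    intro v
    have key : ∀ i : Fin 5, i = 0 ∨ i = 1 ∨ i = 2 ∨ i = 3 ∨ i = 4 := by decide
    rcases key (c v) with h | h | h | h | h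
    · exact hpos v z4 ((hadj _ _).2 (by rw [h, hz4]; decide)) (hxpos4 _ hz4)
    · exact hpos v z2 ((hadj _ _).2 (by rw [h, hz2]; decide)) (hxpos2 _ hz2)
    · exact hxpos2 v h
    · rw [hxT v h]; exact hu
    · exact hxpos4 v h
  have hiff : ∀ z w, (c z = 2 ∨ c z = 4) → (G.Adj z w ↔ H.Adj z w) := fun z w hz =>
    adj_iff_of_nbrSum_eq G H hxpos (fun w hw => hGH' z w hw hz) (by rw [hx, hHx]) w
  have hT' : ∀ v w, c v = 3 → ¬ (c w = 2 ∨ c w = 4) → ¬ G.Adj v w := by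
    intro v w hv hw hvw
    have a2 : G.Adj z2 v := (hiff z2 v (Or.inl hz2)).2 ((hadj _ _).2 (by rw [hv, hz2]; decide))
    have a4 : G.Adj z4 v := (hiff z4 v (Or.inr hz4)).2 ((hadj _ _).2 (by rw [hv, hz4]; decide))
    have key : ∀ i : Fin 5, ¬ (i = 2 ∨ i = 4) → i = 0 ∨ i = 1 ∨ i = 3 := by decide
    rcases key _ hw with h | h | h
    · exact hG.false_of_adj a4
        ((hiff z4 w (Or.inr hz4)).2 ((hadj _ _).2 (by rw [h, hz4]; decide))) hvw
    · exact hG.false_of_adj a2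
        ((hiff z2 w (Or.inl hz2)).2 ((hadj _ _).2 (by rw [h, hz2]; decide))) hvw
    · exact hG.false_of_adj a2
        ((hiff z2 w (Or.inl hz2)).2 ((hadj _ _).2 (by rw [h, hz2]; decide))) hvw
  ext v w
  by_cases hv' : c v = 2 ∨ c v = 4
  · exact hiff v w hv'
  by_cases hw' : c w = 2 ∨ c w = 4
  · rw [G.adj_comm, H.adj_comm]; exact hiff w v hw'
  by_cases hv : c v = 3
  · refine iff_of_false (hT' v w hv hw') ?_
    rw [hadj, hv]
    exact fun h => hw' h.symm
  by_cases hw : c w = 3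
  · refine iff_of_false (fun h => hT' w v hw hv' h.symm) ?_
    rw [H.adj_comm, hadj, hw]
    exact fun h => hv' h.symm
  refine ⟨hGH v hv w hw, fun h => ?_⟩
  rw [hadj] at h
  have key : ∀ i j : Fin 5, i ≠ 3 → ¬ (i = 2 ∨ i = 4) → j ≠ 3 → ¬ (j = 2 ∨ j = 4) →
    (j = i + 1 ∨ j = i - 1) → (i = 0 ∧ j = 1) ∨ (i = 1 ∧ j = 0) := by decide
  rcases key _ _ hv hv' hw hw' h with ⟨h, h'⟩ | ⟨h, h'⟩
  · rw [c0] at h; rw [c1] at h'; subst h h'; exact h12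
  · rw [c1] at h; rw [c0] at h'; subst h h'; exact h12.symm

theorem exists_pentagonBlowup (G : SimpleGraph V) (hG : G.CliqueFree 3) (hnb : ¬ G.IsBipartite)
    (hl : 1 < G.largestEigenvalue) :
    ∃ c : V → Fin 5, (Finset.univ.filter (c · = 0)).card = 1 ∧
      (Finset.univ.filter (c · = 1)).card = 1 ∧ 0 < (Finset.univ.filter (c · = 2)).card ∧
      0 < (Finset.univ.filter (c · = 3)).card ∧ 0 < (Finset.univ.filter (c · = 4)).card ∧
      G.largestEigenvalue ≤ (pentagonBlowup c).largestEigenvalue ∧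
      ((pentagonBlowup c).largestEigenvalue ≤ G.largestEigenvalue → G = pentagonBlowup c) := by
  classical
  have hV : Nonempty V := by
    by_contra h
    rw [not_nonempty_iff] at h
    exact hnb (Colorable.of_isEmpty 2)
  obtain ⟨x, hx0, hxne, hx⟩ := G.exists_nonneg_eigenvector
  obtain ⟨u, -, hmax⟩ := Finset.exists_max_image Finset.univ x Finset.univ_nonempty
  replace hmax : ∀ v, x v ≤ x u := fun v => hmax v (Finset.mem_univ v)
  have hu : 0 < x u := by
    refine lt_of_le_of_ne (hx0 u) fun h => hxne (funext fun v => ?_)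
    exact le_antisymm ((hmax v).trans h.symm.le) (hx0 v)
  let N : Finset V := Finset.univ.filter (G.Adj u)
  have hNmem : ∀ v, v ∈ N ↔ G.Adj u v := fun v => by simp [N]
  -- The eigenvalue equation at the maximum bounds the degree of `u` below by the eigenvalue, which
  -- exceeds 1.
  have hNcard : 1 < N.card := by
    have h1 : G.nbrSum x u ≤ N.card * x u := by
      rw [nbrSum, ← Finset.sum_filter, ← nsmul_eq_mul]
      exact Finset.sum_le_card_nsmul _ _ _ fun v _ => hmax v
    rw [hx] at h1
    have h2 := le_of_mul_le_mul_right h1 hu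
    exact_mod_cast hl.trans_le h2
  have hNN : ∀ v ∈ (N : Set V), ∀ w ∈ (N : Set V), ¬ G.Adj v w := fun v hv w hw h =>
    hG.false_of_adj ((hNmem v).1 hv) ((hNmem w).1 hw) h
  obtain ⟨w₁, w₂, hw1, hw2, h12, hiff⟩ := G.exists_adj_notMem_of_not_isBipartite hnb N hNN
  simp only [Finset.mem_coe] at hw1 hw2 hiff
  -- If `w₁` and `w₂` both have neighbours in `N`, these are disjoint sets and `R` is that of `w₁`.
  -- If neither has any, any proper nonempty subset of `N` serves.
  obtain ⟨R, hRN, hR1, hR2, hR, hR'⟩ : ∃ R ⊆ N, (∀ v ∈ N, v ∉ R → ¬ G.Adj w₁ v) ∧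
      (∀ v ∈ R, ¬ G.Adj w₂ v) ∧ R.Nonempty ∧ ∃ v ∈ N, v ∉ R := by
    by_cases h : ∃ z ∈ N, G.Adj w₁ z
    · obtain ⟨z, hz, hzw⟩ := hiff.1 h
      obtain ⟨z', hz', hzw'⟩ := h
      refine ⟨N.filter (G.Adj w₁), Finset.filter_subset _ _, ?_, ?_, ?_, z, hz, ?_⟩
      · intro v hv hv' h
        exact hv' (Finset.mem_filter.2 ⟨hv, h⟩)
      · intro v hv h
        exact hG.false_of_adj h12 (Finset.mem_filter.1 hv).2 h
      · exact ⟨z', Finset.mem_filter.2 ⟨hz', hzw'⟩⟩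
      · intro hv
        exact hG.false_of_adj h12 (Finset.mem_filter.1 hv).2 hzw
    · have h' := mt hiff.2 h
      push Not at h h'
      obtain ⟨p, hp, q, hq, hpq⟩ := Finset.one_lt_card.1 hNcard
      refine ⟨{p}, by simpa using hp, fun v hv _ => h v hv, ?_, by simp, q, hq, ?_⟩
      · intro v hv
        rw [Finset.mem_singleton.1 hv]
        exact h' p hp
      · simpa using hpq.symm
  let c : V → Fin 5 := fun v => if v = w₁ then 0 else if v = w₂ then 1 else
    if v ∈ R then 4 else if v ∈ N then 2 else 3
  have hne : w₂ ≠ w₁ := h12.ne'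
  have hR1' : w₁ ∉ R := fun h => hw1 (hRN h)
  have hR2' : w₂ ∉ R := fun h => hw2 (hRN h)
  have c0 : ∀ v, c v = 0 ↔ v = w₁ := by
    intro v; simp only [c]; split_ifs <;> simp_all
  have c1 : ∀ v, c v = 1 ↔ v = w₂ := by
    intro v; simp only [c]; split_ifs <;> simp_all [hne.symm]
  have c2 : ∀ v, c v = 2 ↔ v ∈ N ∧ v ∉ R := by
    intro v; simp only [c]; split_ifs <;> simp_all
  have c4 : ∀ v, c v = 4 ↔ v ∈ R := by
    intro v; simp only [c]; split_ifs <;> simp_all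
  have huN : u ∉ N := by simp [N]
  have hu1 : u ≠ w₁ := by rintro rfl; exact hw2 ((hNmem _).2 h12)
  have hu2 : u ≠ w₂ := by rintro rfl; exact hw1 ((hNmem _).2 h12.symm)
  have hu3 : c u = 3 := by
    simp only [c]
    rw [if_neg hu1, if_neg hu2, if_neg fun h => huN (hRN h), if_neg huN]
  have h2 : ∃ v, c v = 2 := by
    obtain ⟨v, hv⟩ := hR'
    exact ⟨v, (c2 v).2 hv⟩
  have h4 : ∃ v, c v = 4 := by
    obtain ⟨v, hv⟩ := hR
    exact ⟨v, (c4 v).2 hv⟩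
  have hcard : ∀ i, (∃ v, c v = i) → 0 < (Finset.univ.filter (c · = i)).card := fun i ⟨v, hv⟩ =>
    Finset.card_pos.2 ⟨v, by simpa using hv⟩
  refine ⟨c, ?_, ?_, hcard 2 h2, hcard 3 ⟨u, hu3⟩, hcard 4 h4, ?_⟩
  · exact Finset.card_eq_one.2 ⟨w₁, by ext v; simp [c0]⟩
  · exact Finset.card_eq_one.2 ⟨w₂, by ext v; simp [c1]⟩
  refine G.exists_pentagonBlowup_of_fibers hG hx0 hx (by linarith) hu hmax c c0 c1 hu3 ?_ h2 h4 h12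
    ?_ ?_
  · intro v
    rw [← hNmem, c2, c4]
    constructor
    · intro h; by_cases hv : v ∈ R
      exacts [Or.inr hv, Or.inl ⟨h, hv⟩]
    · rintro (h | h)
      exacts [h.1, hRN h]
  · intro v hv
    exact hR1 v ((c2 v).1 hv).1 ((c2 v).1 hv).2
  · intro v hv
    exact hR2 v ((c4 v).1 hv)

end SimpleGraph

/-! ### The subdivided bipartite graph as a blow-up, and the conclusion. -/

namespace SimpleGraph

theorem cliqueFree_pentagonBlowup {V : Type*} (c : V → Fin 5) : (pentagonBlowup c).CliqueFree 3 := by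
  classical
  intro s hs
  obtain ⟨x, y, z, hxy, hxz, hyz, -⟩ := is3Clique_iff.1 hs
  rw [pentagonBlowup_adj] at hxy hxz hyz
  have key : ∀ i j k : Fin 5, (j = i + 1 ∨ j = i - 1) → (k = i + 1 ∨ k = i - 1) →
    (k = j + 1 ∨ k = j - 1) → False := by decide
  exact key _ _ _ hxy hxz hyz

theorem exists_subdivideEdge_eq_pentagonBlowup {a b : ℕ} {e : Sym2 (Fin a ⊕ Fin b)}
    (he : e ∈ (completeBipartiteGraph (Fin a) (Fin b)).edgeSet) :
    ∃ c : Option (Fin a ⊕ Fin b) → Fin 5,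
      (completeBipartiteGraph (Fin a) (Fin b)).subdivideEdge e = pentagonBlowup c ∧
      (Finset.univ.filter (c · = 0)).card = 1 ∧ (Finset.univ.filter (c · = 1)).card = 1 ∧
      (Finset.univ.filter (c · = 2)).card = b - 1 ∧ (Finset.univ.filter (c · = 3)).card = a - 1 ∧
      (Finset.univ.filter (c · = 4)).card = 1 := by
  classical
  obtain ⟨i, j, rfl⟩ : ∃ i j, e = s(Sum.inl i, Sum.inr j) := by
    induction e using Sym2.ind with
    | _ x y =>
      rw [mem_edgeSet, completeBipartiteGraph_adj] at he
      rcases x with i | i <;> rcases y with j | j <;> simp at he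
      · exact ⟨i, j, rfl⟩
      · exact ⟨j, i, Sym2.eq_swap⟩
  -- The pentagon runs through the new vertex, `inl i`, the other right vertices, the other left
  -- vertices, and `inr j`.
  refine ⟨fun o => o.elim 0 (Sum.elim (fun k => if k = i then 1 else 3)
    (fun k => if k = j then 4 else 2)), ?_, ?_, ?_, ?_, ?_, ?_⟩
  · ext v w
    rw [pentagonBlowup_adj]
    rcases v with _ | v | v <;> rcases w with _ | w | w <;>
      simp [subdivideEdge] <;> split_ifs <;> simp_all <;> decide
  · refine Finset.card_eq_one.2 ⟨none, ?_⟩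
    ext v
    rcases v with _ | v | v <;> simp <;> split_ifs <;> decide
  · refine Finset.card_eq_one.2 ⟨some (Sum.inl i), ?_⟩
    ext v
    rcases v with _ | v | v <;> simp
    split_ifs <;> decide
  · have : (Finset.univ.filter fun o : Option (Fin a ⊕ Fin b) =>
        o.elim (0 : Fin 5) (Sum.elim (fun k => if k = i then 1 else 3)
          (fun k => if k = j then 4 else 2)) = 2) =
        ((Finset.univ.erase j).map ⟨Sum.inr, Sum.inr_injective⟩).map
          Function.Embedding.some := by
      ext v
      rcases v with _ | v | v <;> simp
      split_ifs <;> decide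
    rw [this]
    simp
  · have : (Finset.univ.filter fun o : Option (Fin a ⊕ Fin b) =>
        o.elim (0 : Fin 5) (Sum.elim (fun k => if k = i then 1 else 3)
          (fun k => if k = j then 4 else 2)) = 3) =
        ((Finset.univ.erase i).map ⟨Sum.inl, Sum.inl_injective⟩).map
          Function.Embedding.some := by
      ext v
      rcases v with _ | v | v <;> simp
      split_ifs <;> decide
    rw [this]
    simp
  · refine Finset.card_eq_one.2 ⟨some (Sum.inr j), ?_⟩
    ext v
    rcases v with _ | v | v <;> simp
    split_ifs <;> decide

theorem nonempty_iso_pentagonBlowup_of_symm {V W : Type*} [Fintype V] [Fintype W]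
    (c : V → Fin 5) (c' : W → Fin 5) (f g : Fin 5 → Fin 5)
    (hf : ∀ i j, (f j = f i + 1 ∨ f j = f i - 1) ↔ (j = i + 1 ∨ j = i - 1))
    (hfg : ∀ i j, f i = j ↔ i = g j)
    (h : ∀ i, (Finset.univ.filter (c · = g i)).card = (Finset.univ.filter (c' · = i)).card) :
    Nonempty (pentagonBlowup c ≃g pentagonBlowup c') := by
  rw [← pentagonBlowup_comp c f hf]
  refine nonempty_iso_pentagonBlowup _ _ fun i => ?_
  rw [← h]
  simp only [hfg]

end SimpleGraph

open SimpleGraph in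
theorem mainTheorem3 {V : Type*} [Fintype V] (G : SimpleGraph V) (n : ℕ)
    (hn : Fintype.card V = n) (hG : ¬ G.IsBipartite)
    (e : Sym2 (Fin ((n - 1) / 2) ⊕ Fin (n / 2)))
    (he : e ∈ (balancedCompleteBipartite n).edgeSet)
    (hlam : ((balancedCompleteBipartite n).subdivideEdge e).largestEigenvalue ≤
      G.largestEigenvalue) :
    (¬ Nonempty (G ≃g (balancedCompleteBipartite n).subdivideEdge e) → ¬ G.CliqueFree 3) ∧
      (Nonempty (G ≃g (balancedCompleteBipartite n).subdivideEdge e) → G.CliqueFree 3) := by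
  obtain ⟨c', hc', m0, m1, m2, m3, m4⟩ := exists_subdivideEdge_eq_pentagonBlowup he
  rw [hc'] at hlam ⊢
  refine ⟨fun hiso hfree => hiso ?_, fun ⟨φ⟩ =>
    (cliqueFree_pentagonBlowup c').comap ⟨φ.toCopy⟩⟩
  have hbound := two_mul_le_largestEigenvalue_mul c' m0 m1 m2 m3 m4
  -- The average degree already exceeds 1, even when some classes are empty.
  have hν1 : 1 < (pentagonBlowup c').largestEigenvalue := by
    by_contra hcon
    have h1 : (0 : ℝ) ≤ ((n / 2 - 1 : ℕ) : ℝ) := Nat.cast_nonneg _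
    have h2 : (0 : ℝ) ≤ (((n - 1) / 2 - 1 : ℕ) : ℝ) := Nat.cast_nonneg _
    have h3 := mul_nonneg h1 h2
    have h4 := mul_le_mul_of_nonneg_right (not_lt.1 hcon)
      (by positivity : (0 : ℝ) ≤ 2 + ((n / 2 - 1 : ℕ) : ℝ) + (((n - 1) / 2 - 1 : ℕ) : ℝ) + (1 : ℕ))
    push_cast at hbound h4
    linarith
  obtain ⟨c, n0, n1, n2, n3, n4, hle, heq⟩ :=
    G.exists_pentagonBlowup hfree hG (hν1.trans_le hlam)
  have : Nonempty V := by
    obtain ⟨v, -⟩ := Finset.card_pos.1 n2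
    exact ⟨v⟩
  obtain ⟨s, hs⟩ : ∃ s, (Finset.univ.filter (c · = 2)).card = s := ⟨_, rfl⟩
  obtain ⟨t, ht⟩ : ∃ t, (Finset.univ.filter (c · = 3)).card = t := ⟨_, rfl⟩
  obtain ⟨r, hr⟩ : ∃ r, (Finset.univ.filter (c · = 4)).card = r := ⟨_, rfl⟩
  rw [hs] at n2
  rw [ht] at n3
  rw [hr] at n4
  have htot : 2 + s + t + r = n := by
    have := Finset.card_eq_sum_card_fiberwise (f := c) (s := Finset.univ) (t := Finset.univ)
      fun _ _ => Finset.mem_coe.2 (Finset.mem_univ _)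
    rw [Fin.sum_univ_five, n0, n1, hs, ht, hr, Finset.card_univ, hn] at this
    omega
  obtain ⟨a, ha⟩ : ∃ a, (n - 1) / 2 - 1 = a := ⟨_, rfl⟩
  obtain ⟨b, hb⟩ : ∃ b, n / 2 - 1 = b := ⟨_, rfl⟩
  rw [ha] at m3 hbound
  rw [hb] at m2 hbound
  have hνμ := hlam.trans hle
  -- The five classes of `c` are nonempty, so `n ≥ 5` and both `a` and `b` are positive.
  have hS : pentagonPoly b a 1 (pentagonBlowup c').largestEigenvalue = 0 := by
    have := pentagonPoly_largestEigenvalue c' (by linarith) (by omega) (by omega) (by omega)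
      m0 m1 m2 m3 m4
    simpa using this
  have hH := pentagonPoly_largestEigenvalue c (by linarith) n2 n3 n4 n0 n1 hs ht hr
  obtain ⟨hμ, hrs, hq⟩ := eq_of_pentagonPoly_eq_zero (a := a) (b := b) (by omega) (by omega)
    n2 n3 n4 (by omega) (by omega) (by omega) hν1 (by push_cast at hbound; linarith) hνμ hS hH
  rw [heq (hμ.trans_le hlam)]
  have hcases : ∀ p q : ℕ, p + q = a + b → p * q = a * b → p = a ∧ q = b ∨ p = b ∧ q = a := by
    intro p q h1 h2
    obtain rfl : q = a + b - p := by omega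
    have h3 : ((p : ℤ) - a) * (p - b) = 0 := by
      have : ((a + b - p : ℕ) : ℤ) = a + b - p := by omega
      have h2' : (p : ℤ) * ((a + b - p : ℕ) : ℤ) = a * b := by exact_mod_cast h2
      rw [this] at h2'
      linarith
    rcases mul_eq_zero.1 h3 with h | h <;> omega
  -- Three consecutive classes are singletons, and the other two have sizes `a` and `b` in some
  -- order. A rotation or reflection of the pentagon matches them with those of `c'`.
  rcases hrs with rfl | rfl
  · rw [Nat.add_sub_cancel_left] at hq
    rcases hcases s t (by omega) hq with ⟨rfl, rfl⟩ | ⟨rfl, rfl⟩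
    · refine nonempty_iso_pentagonBlowup_of_symm c c' (fun i => -i) (fun i => -i)
        (by decide) (by decide) fun i => ?_
      fin_cases i
      exacts [n0.trans m0.symm, hr.trans m1.symm, ht.trans m2.symm, hs.trans m3.symm,
        n1.trans m4.symm]
    · refine nonempty_iso_pentagonBlowup c c' fun i => ?_
      fin_cases i
      exacts [n0.trans m0.symm, n1.trans m1.symm, hs.trans m2.symm, ht.trans m3.symm,
        hr.trans m4.symm]
  · rw [Nat.add_sub_cancel] at hq
    rcases hcases r t (by omega) hq with ⟨rfl, rfl⟩ | ⟨rfl, rfl⟩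
    · refine nonempty_iso_pentagonBlowup_of_symm c c' (fun i => i - 1) (fun i => i + 1)
        (by decide) (by decide) fun i => ?_
      fin_cases i
      exacts [n1.trans m0.symm, hs.trans m1.symm, ht.trans m2.symm, hr.trans m3.symm,
        n0.trans m4.symm]
    · refine nonempty_iso_pentagonBlowup_of_symm c c' (fun i => 1 - i) (fun i => 1 - i)
        (by decide) (by decide) fun i => ?_
      fin_cases i
      exacts [n1.trans m0.symm, n0.trans m1.symm, hr.trans m2.symm, ht.trans m3.symm,
        hs.trans m4.symm]
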